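/- Let $R$ be a commutative Noetherian ring with non-zero identity, and let $C$ be a semidualizing $R$-module, that is, a finitely generated $R$-module such that the homothety map $R\to\operatorname{Hom}_R(C,C)$ is an isomorphism and $\operatorname{Ext}^i_R(C,C)=0$ for all $i>0$. An $R$-module is called $C$-projective (resp. $C$-flat, $C$-injective) if it is isomorphic to $C\otimes_R P$ with $P$ projective (resp. $C\otimes_R F$ with $F$ flat, $\operatorname{Hom}_R(C,I)$ with $I$ injective). For an $R$-module $M$, let $C\text{-}\mathrm{pd}_R(M)$ be the infimum of $\sup\{n\ge 0\mid X_n\neq 0\}$ over all complexes $X=(\cdots\to X_1\to X_0\to 0)$ of $C$-projective modules with $H_0(X)\cong M$ and $H_n(X)=0$ for all $n\ge1$. Dually, let $C\text{-}\mathrm{id}_R(M)$ be the infimum of $\sup\{n\ge 0\mid Y^n\neq 0\}$ over all complexes $Y=(0\to Y^0\to Y^1\to\cdots)$ of $C$-injective modules with $H^0(Y)\cong M$ and $H^n(Y)=0$ for all $n\ge1$. (Here $\sup\emptyset=-\infty$ and $\inf\emptyset=\infty$.) Call $M$ strongly $C$-copure injective if $\operatorname{Ext}^i_R(X,M)=0$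 for every $C$-injective $R$-module $X$ and every $i\ge1$, and strongly $C$-copure projective if $\operatorname{Ext}^i_R(M,X)=0$ for every $C$-flat $R$-module $X$ and every $i\ge1$. Theorem. Let $M$ be an $R$-module. (i) $M$ is $C$-injective if and only if $M$ is strongly $C$-copure injective and $C\text{-}\mathrm{id}_R(M)<\infty$. (ii) $M$ is $C$-projective if and only if $M$ is strongly $C$-copure projective and $C\text{-}\mathrm{pd}_R(M)<\infty$. -/

import Mathlib

universe u

open CategoryTheory TensorProduct

noncomputable section

namespace Semidualizing

variable {R : Type u} [CommRing R]

/-- A finitely generated `R`-module `C` is semidualizing if the homothety map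
`R → Hom_R(C, C)`, `r ↦ (c ↦ r • c)`, is an isomorphism and `Ext^i_R(C, C) = 0` for `i > 0`. -/
structure IsSemidualizing (C : ModuleCat.{u} R) : Prop where
  finite : Module.Finite R C
  homothety_bijective : Function.Bijective (LinearMap.lsmul R C)
  ext_eq_zero : ∀ i : ℕ, 0 < i → Subsingleton (Abelian.Ext C C i)

/-- The class `𝒫_C` of `C`-projective modules: those isomorphic to `C ⊗_R P`, `P` projective. -/
def CProjective (C : ModuleCat.{u} R) : ObjectProperty (ModuleCat.{u} R) := fun M =>
  ∃ P : ModuleCat.{u} R, Module.Projective R P ∧ Nonempty (M ≃ₗ[R] (C ⊗[R] P))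

/-- The class `ℱ_C` of `C`-flat modules: those isomorphic to `C ⊗_R F`, `F` flat. -/
def CFlat (C : ModuleCat.{u} R) : ObjectProperty (ModuleCat.{u} R) := fun M =>
  ∃ F : ModuleCat.{u} R, Module.Flat R F ∧ Nonempty (M ≃ₗ[R] (C ⊗[R] F))

/-- The class `ℐ_C` of `C`-injective modules: those isomorphic to `Hom_R(C, I)`, `I` injective. -/
def CInjective (C : ModuleCat.{u} R) : ObjectProperty (ModuleCat.{u} R) := fun M =>
  ∃ I : ModuleCat.{u} R, Module.Injective R I ∧ Nonempty (M ≃ₗ[R] (C →ₗ[R] I))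

/-- `M` is strongly `C`-copure injective: `Ext^i_R(ℐ_C, M) = 0` for all `i ≥ 1`. -/
def StronglyCCopureInjective (C : ModuleCat.{u} R) : ObjectProperty (ModuleCat.{u} R) := fun M =>
  ∀ X : ModuleCat.{u} R, CInjective C X → ∀ i : ℕ, 1 ≤ i → Subsingleton (Abelian.Ext X M i)

/-- `M` is strongly `C`-copure projective: `Ext^i_R(M, ℱ_C) = 0` for all `i ≥ 1`. -/
def StronglyCCopureProjective (C : ModuleCat.{u} R) : ObjectProperty (ModuleCat.{u} R) := fun M =>
  ∀ X : ModuleCat.{u} R, CFlat C X → ∀ i : ℕ, 1 ≤ i → Subsingleton (Abelian.Ext M X i)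

/-- An `𝒳`-resolution of `M`: a complex `⋯ → K₁ → K₀ → 0` of modules in `𝒳` such that
`H₀(K) ≅ M` and `Hₙ(K) = 0` for `n ≥ 1`. -/
structure IsResolution (𝒳 : ObjectProperty (ModuleCat.{u} R)) (M : ModuleCat.{u} R)
    (K : ChainComplex (ModuleCat.{u} R) ℕ) : Prop where
  mem : ∀ n, 𝒳 (K.X n)
  homology_zero : Nonempty (K.homology 0 ≅ M)
  exact : ∀ n, 1 ≤ n → K.ExactAt n

/-- An `𝒳`-coresolution of `M`: a complex `0 → K⁰ → K¹ → ⋯` of modules in `𝒳` such that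
`H⁰(K) ≅ M` and `Hⁿ(K) = 0` for `n ≥ 1`. -/
structure IsCoresolution (𝒳 : ObjectProperty (ModuleCat.{u} R)) (M : ModuleCat.{u} R)
    (K : CochainComplex (ModuleCat.{u} R) ℕ) : Prop where
  mem : ∀ n, 𝒳 (K.X n)
  homology_zero : Nonempty (K.homology 0 ≅ M)
  exact : ∀ n, 1 ≤ n → K.ExactAt n

/-- The `𝒳`-projective dimension `inf { sup { n ≥ 0 | Kₙ ≠ 0 } | K an 𝒳-resolution of M }`,
with value `⊥ = -∞` for the zero complex and `⊤ = ∞` if there is no `𝒳`-resolution. -/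
def relProjDim (𝒳 : ObjectProperty (ModuleCat.{u} R)) (M : ModuleCat.{u} R) : WithBot ℕ∞ :=
  ⨅ (K : ChainComplex (ModuleCat.{u} R) ℕ) (_ : IsResolution 𝒳 M K),
    ⨆ (n : ℕ) (_ : Nontrivial (K.X n)), (n : WithBot ℕ∞)

/-- The `𝒳`-injective dimension `inf { sup { n ≥ 0 | Kⁿ ≠ 0 } | K an 𝒳-coresolution of M }`,
with value `⊥ = -∞` for the zero complex and `⊤ = ∞` if there is no `𝒳`-coresolution. -/
def relInjDim (𝒳 : ObjectProperty (ModuleCat.{u} R)) (M : ModuleCat.{u} R) : WithBot ℕ∞ :=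
  ⨅ (K : CochainComplex (ModuleCat.{u} R) ℕ) (_ : IsCoresolution 𝒳 M K),
    ⨆ (n : ℕ) (_ : Nontrivial (K.X n)), (n : WithBot ℕ∞)

/-- The `C`-projective dimension, `C-pd_R(M)`. -/
def cProjDim (C M : ModuleCat.{u} R) : WithBot ℕ∞ := relProjDim (CProjective C) M

/-- The `C`-injective dimension, `C-id_R(M)`. -/
def cInjDim (C M : ModuleCat.{u} R) : WithBot ℕ∞ := relInjDim (CInjective C) M

end Semidualizing

end

/-! Two facts carry the theorem: for i ≥ 1, Ext^i(Hom(C,J), Hom(C,I)) and Ext^i(C ⊗ P, C ⊗ F) vanish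
(I, J injective, P projective, F flat), and both classes are closed under retracts.

Vanishing is proved with a finitely generated N satisfying Ext^i(N,C) = 0 for i ≥ 1 in place of one
copy of C, because this condition passes to syzygies. Applying Hom(-,I) or - ⊗ P to 0 → N' → R^k → N
→ 0 gives an injective or projective middle term, so dimension shifting leaves degree one. There,
adjunction reduces the claim to injectivity of Hom(C,J) ⊗ N' → Hom(C,J) ⊗ R^k, or surjectivity of
Hom(R^k, C ⊗ F) → Hom(N', C ⊗ F). By `homEvalMap_bijective` and `rTensorHomToHomRTensor_bijective`,
both follow from surjectivity of Hom(R^k,C) → Hom(N',C), that is, from Ext^1(N,C) = 0.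

Conversely, in a bounded coresolution of a copure injective M every cocycle module Z^k is copure
injective. Descending from Z^n = 0, once Z^{k+1} is C-injective the sequence 0 → Z^k → K^k → Z^{k+1}
→ 0 splits, and Z^k is a retract of K^k. Part (ii) is dual. -/

namespace Semidualizing

/-! ### Natural isomorphisms for finitely presented modules -/

section Modules

variable {R : Type u} [CommRing R]

/-- The natural map `Hom(C, J) ⊗ K → Hom(Hom(K, C), J)`, `f ⊗ k ↦ (φ ↦ f (φ k))`. -/
def homEvalMap (C J K : Type u) [AddCommGroup C] [Module R C] [AddCommGroup J] [Module R J]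
    [AddCommGroup K] [Module R K] : (C →ₗ[R] J) ⊗[R] K →ₗ[R] ((K →ₗ[R] C) →ₗ[R] J) :=
  TensorProduct.lift (LinearMap.mk₂ R (fun f k => f ∘ₗ LinearMap.applyₗ k)
    (fun f g k => by ext; simp) (fun r f k => by ext; simp)
    (fun f k l => by ext; simp) (fun r f k => by ext; simp))

variable (C J K F : Type u) [AddCommGroup C] [Module R C] [AddCommGroup J] [Module R J]
    [AddCommGroup K] [Module R K] [AddCommGroup F] [Module R F]

@[simp]
lemma homEvalMap_tmul (f : C →ₗ[R] J) (k : K) (φ : K →ₗ[R] C) :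
    homEvalMap C J K (f ⊗ₜ k) φ = f (φ k) := rfl

lemma homEvalMap_bijective_pi (n : ℕ) :
    Function.Bijective (homEvalMap (R := R) C J (Fin n → R)) := by
  -- The inverse tests h on the maps v ↦ v_i • c and attaches the result to the basis vector e_i.
  let g : ((((Fin n → R) →ₗ[R] C) →ₗ[R] J)) →ₗ[R] (C →ₗ[R] J) ⊗[R] (Fin n → R) :=
    ∑ i, (TensorProduct.mk R (C →ₗ[R] J) (Fin n → R)).flip (Pi.single i 1) ∘ₗ
      LinearMap.lcomp R J (LinearMap.smulRightₗ (LinearMap.proj (R := R) i))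
  have hg (h : ((Fin n → R) →ₗ[R] C) →ₗ[R] J) : g h = ∑ i,
      (h ∘ₗ LinearMap.smulRightₗ (LinearMap.proj (R := R) i)) ⊗ₜ[R] Pi.single i (1 : R) := by
    simp [g, LinearMap.sum_apply]
    rfl
  refine Function.bijective_iff_has_inverse.mpr ⟨g, fun x => ?_, fun h => ?_⟩
  · induction x with
    | zero => simp
    | add x y hx hy => rw [map_add, map_add, hx, hy]
    | tmul f v =>
      rw [hg]
      have (i : Fin n) : (homEvalMap C J (Fin n → R) (f ⊗ₜ v)) ∘ₗ
          LinearMap.smulRightₗ (LinearMap.proj (R := R) i) = v i • f := by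
        ext c; simp
      simp_rw [this, TensorProduct.smul_tmul, ← TensorProduct.tmul_sum]
      congr 1
      ext j
      simp [Finset.sum_apply, Pi.single_apply]
  · ext φ
    rw [hg, map_sum, LinearMap.sum_apply]
    simp only [homEvalMap_tmul, LinearMap.comp_apply]
    rw [← map_sum]
    congr 1
    ext j
    simp [Pi.single_apply, ite_smul]

/-- `Hom(-, J)` is exact for `J` injective. -/
lemma lcomp_exact_of_injective [Module.Injective R J] {A B D : Type u} [AddCommGroup A]
    [Module R A] [AddCommGroup B] [Module R B] [AddCommGroup D] [Module R D]
    {f : A →ₗ[R] B} {g : B →ₗ[R] D} (hfg : Function.Exact f g) :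
    Function.Exact (LinearMap.lcomp R J g) (LinearMap.lcomp R J f) := by
  intro h
  refine ⟨fun hh => ?_, ?_⟩
  · have hker : LinearMap.ker g ≤ LinearMap.ker h := by
      rw [hfg.linearMap_ker_eq]
      exact LinearMap.range_le_ker_iff.mpr hh
    obtain ⟨h', hh'⟩ := Module.Injective.extension_property R J _ _
      ((LinearMap.ker g).liftQ g le_rfl)
      (LinearMap.ker_eq_bot.mp (Submodule.ker_liftQ_eq_bot _ _ _ le_rfl))
      ((LinearMap.ker g).liftQ h hker)
    refine ⟨h', ?_⟩
    ext x
    exact LinearMap.congr_fun hh' (Submodule.Quotient.mk x)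
  · rintro ⟨y, rfl⟩
    ext x
    exact (congrArg y (hfg.apply_apply_eq_zero x)).trans (map_zero y)

/-- For `K` finitely presented and `J` injective, `Hom(C, J) ⊗ K ≅ Hom(Hom(K, C), J)`. -/
lemma homEvalMap_bijective [Module.FinitePresentation R K] [hJ : Module.Injective R J] :
    Function.Bijective (homEvalMap (R := R) C J K) := by
  obtain ⟨n, m, f, g, hf, hfg⟩ := Module.FinitePresentation.exists_fin' R K
  -- Five lemma on a finite presentation: both sides are right exact in K, the target because J is
  -- injective.
  refine LinearMap.bijective_of_surjective_of_bijective_of_right_exact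
    (g.lTensor (C →ₗ[R] J)) (f.lTensor (C →ₗ[R] J))
    (LinearMap.lcomp R J (LinearMap.lcomp R C g)) (LinearMap.lcomp R J (LinearMap.lcomp R C f))
    (homEvalMap C J _) (homEvalMap C J _) (homEvalMap C J K) ?_ ?_ (lTensor_exact _ hfg hf) ?_
    (homEvalMap_bijective_pi C J _).2 (homEvalMap_bijective_pi C J _)
    (LinearMap.lTensor_surjective _ hf) ?_
  · ext; rfl
  · ext; rfl
  · exact lcomp_exact_of_injective J (LinearMap.exact_lcomp_of_exact_of_surjective C hfg hf)
  · intro h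
    obtain ⟨h', hh'⟩ := Module.Injective.extension_property R J _ _ (LinearMap.lcomp R C f)
      (LinearMap.lcomp_injective_of_surjective f hf) h
    exact ⟨h', hh'⟩

/-- For `K` finitely presented and `F` flat, `Hom(K, C) ⊗ F ≅ Hom(K, C ⊗ F)`. -/
lemma rTensorHomToHomRTensor_bijective [Module.FinitePresentation R K] [Module.Flat R F] :
    Function.Bijective (TensorProduct.rTensorHomToHomRTensor (.id R) K C F) := by
  obtain ⟨n, m, f, g, hf, hfg⟩ := Module.FinitePresentation.exists_fin' R K
  have free (k : ℕ) : Function.Bijective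
      (TensorProduct.rTensorHomToHomRTensor (.id R) (Fin k → R) C F) := by
    rw [← rTensorHomEquivHomRTensor_toLinearMap]
    exact (rTensorHomEquivHomRTensor R (Fin k → R) C F).bijective
  refine LinearMap.bijective_of_bijective_of_injective_of_left_exact
    ((LinearMap.lcomp R C f).rTensor F) ((LinearMap.lcomp R C g).rTensor F)
    (LinearMap.lcomp R (C ⊗[R] F) f) (LinearMap.lcomp R (C ⊗[R] F) g)
    _ _ _ ?_ ?_
    (Module.Flat.rTensor_exact F (LinearMap.exact_lcomp_of_exact_of_surjective C hfg hf))
    (LinearMap.exact_lcomp_of_exact_of_surjective _ hfg hf)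
    (free _) (free _).1
    (Module.Flat.rTensor_preserves_injective_linearMap _
      (LinearMap.lcomp_injective_of_surjective f hf))
    (LinearMap.lcomp_injective_of_surjective f hf)
  · ext; rfl
  · ext; rfl

end Modules

/-! ### Long exact sequences and dimension shifting -/

section ExtLemmas

open Abelian

variable {R : Type u} [CommRing R] {S : ShortComplex (ModuleCat.{u} R)}

/-- Vanishing at X₂ makes the connecting map Hom(X₁,Y) → Ext^1(X₃,Y) onto, while extendability of
every f makes it zero. -/
lemma subsingleton_ext_one_X₃ (hS : S.ShortExact) (Y : ModuleCat.{u} R) (h₂ : Subsingleton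
    (Ext S.X₂ Y 1))
    (h : ∀ f : S.X₁ ⟶ Y, ∃ g : S.X₂ ⟶ Y, S.f ≫ g = f) : Subsingleton (Ext S.X₃ Y 1) := by
  refine subsingleton_of_forall_eq 0 fun x => ?_
  obtain ⟨y, rfl⟩ := Ext.contravariant_sequence_exact₃ hS Y x (Subsingleton.elim _ _) (add_zero 1)
  obtain ⟨f, rfl⟩ := Ext.homEquiv₀.symm.surjective y
  obtain ⟨g, rfl⟩ := h f
  change hS.extClass.comp (Ext.mk₀ (S.f ≫ g)) _ = 0
  rw [← Ext.mk₀_comp_mk₀]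
  exact hS.extClass_comp_assoc _

lemma exists_extension_of_subsingleton_ext_one (hS : S.ShortExact) {Y : ModuleCat.{u} R}
    (h₃ : Subsingleton (Ext S.X₃ Y 1)) (f : S.X₁ ⟶ Y) : ∃ g : S.X₂ ⟶ Y, S.f ≫ g = f := by
  obtain ⟨y, hy⟩ := Ext.contravariant_sequence_exact₁ hS Y (Ext.mk₀ f) (add_zero 1)
    (Subsingleton.elim _ _)
  obtain ⟨g, rfl⟩ := Ext.homEquiv₀.symm.surjective y
  refine ⟨g, Ext.homEquiv₀.symm.injective ?_⟩
  change Ext.mk₀ _ = Ext.mk₀ _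
  rw [← Ext.mk₀_comp_mk₀]
  exact hy

lemma subsingleton_ext_X₃ (hS : S.ShortExact) {Y : ModuleCat.{u} R} {n : ℕ} (h₁ : Subsingleton
    (Ext S.X₁ Y n))
    (h₂ : Subsingleton (Ext S.X₂ Y (n + 1))) : Subsingleton (Ext S.X₃ Y (n + 1)) := by
  refine subsingleton_of_forall_eq 0 fun x => ?_
  obtain ⟨y, rfl⟩ := Ext.contravariant_sequence_exact₃ hS Y x (Subsingleton.elim _ _)
    (add_comm 1 n)
  rw [Subsingleton.elim y 0, Ext.comp_zero]

lemma subsingleton_ext_X₁ (hS : S.ShortExact) {Y : ModuleCat.{u} R} {n : ℕ} (h₂ : Subsingleton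
    (Ext S.X₂ Y n))
    (h₃ : Subsingleton (Ext S.X₃ Y (n + 1))) : Subsingleton (Ext S.X₁ Y n) := by
  refine subsingleton_of_forall_eq 0 fun x => ?_
  obtain ⟨y, rfl⟩ := Ext.contravariant_sequence_exact₁ hS Y x (add_comm 1 n)
    (Subsingleton.elim _ _)
  rw [Subsingleton.elim y 0, Ext.comp_zero]

lemma subsingleton_ext_one_to_X₁ (hS : S.ShortExact) (X : ModuleCat.{u} R) (h₂ : Subsingleton
    (Ext X S.X₂ 1))
    (h : ∀ f : X ⟶ S.X₃, ∃ g : X ⟶ S.X₂, g ≫ S.g = f) : Subsingleton (Ext X S.X₁ 1) := by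
  refine subsingleton_of_forall_eq 0 fun x => ?_
  obtain ⟨y, rfl⟩ := Ext.covariant_sequence_exact₁ X hS x (Subsingleton.elim _ _) (zero_add 1)
  obtain ⟨f, rfl⟩ := Ext.homEquiv₀.symm.surjective y
  obtain ⟨g, rfl⟩ := h f
  change (Ext.mk₀ (g ≫ S.g)).comp hS.extClass _ = 0
  rw [← Ext.mk₀_comp_mk₀, Ext.comp_assoc _ _ _ _ (zero_add 1) (by omega), hS.comp_extClass, Ext.comp_zero]

lemma exists_lift_of_subsingleton_ext_one (hS : S.ShortExact) {X : ModuleCat.{u} R}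
    (h₁ : Subsingleton (Ext X S.X₁ 1)) (f : X ⟶ S.X₃) : ∃ g : X ⟶ S.X₂, g ≫ S.g = f := by
  obtain ⟨y, hy⟩ := Ext.covariant_sequence_exact₃ X hS (Ext.mk₀ f) (zero_add 1)
    (Subsingleton.elim _ _)
  obtain ⟨g, rfl⟩ := Ext.homEquiv₀.symm.surjective y
  refine ⟨g, Ext.homEquiv₀.symm.injective ?_⟩
  change Ext.mk₀ _ = Ext.mk₀ _
  rw [← Ext.mk₀_comp_mk₀]
  exact hy

lemma subsingleton_ext_to_X₁ (hS : S.ShortExact) {X : ModuleCat.{u} R} {n : ℕ} (h₃ : Subsingleton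
    (Ext X S.X₃ n))
    (h₂ : Subsingleton (Ext X S.X₂ (n + 1))) : Subsingleton (Ext X S.X₁ (n + 1)) := by
  refine subsingleton_of_forall_eq 0 fun x => ?_
  obtain ⟨y, rfl⟩ := Ext.covariant_sequence_exact₁ X hS x (Subsingleton.elim _ _) rfl
  rw [Subsingleton.elim y 0, Ext.zero_comp]

lemma subsingleton_ext_to_X₃ (hS : S.ShortExact) {X : ModuleCat.{u} R} {n : ℕ} (h₂ : Subsingleton
    (Ext X S.X₂ n))
    (h₁ : Subsingleton (Ext X S.X₁ (n + 1))) : Subsingleton (Ext X S.X₃ n) := by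
  refine subsingleton_of_forall_eq 0 fun x => ?_
  obtain ⟨y, rfl⟩ := Ext.covariant_sequence_exact₃ X hS x rfl (Subsingleton.elim _ _)
  rw [Subsingleton.elim y 0, Ext.zero_comp]

lemma subsingleton_ext_of_iso {X X' Y Y' : ModuleCat.{u} R} (e : X ≅ X') (e' : Y ≅ Y') {n : ℕ}
    (h : Subsingleton (Ext X Y n)) : Subsingleton (Ext X' Y' n) := by
  have inj₁ : Function.Injective (fun x : Ext X' Y' n =>
      (Ext.mk₀ e.hom).comp x (zero_add n)) := by
    refine Function.LeftInverse.injective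
      (g := fun x => (Ext.mk₀ e.inv).comp x (zero_add n)) fun x => ?_
    simp
  have inj₂ : Function.Injective (fun x : Ext X Y' n => x.comp (Ext.mk₀ e'.inv) (add_zero n)) := by
    refine Function.LeftInverse.injective
      (g := fun x => x.comp (Ext.mk₀ e'.hom) (add_zero n)) fun x => ?_
    simp
  exact (inj₂.comp inj₁).subsingleton

end ExtLemmas

/-! ### Closure of the two classes under retracts -/

section Retracts

variable {R : Type u} [CommRing R]

lemma injective_of_retract {Q E : Type u} [AddCommGroup Q] [Module R Q] [AddCommGroup E]
    [Module R E] [Module.Injective R E] (i : Q →ₗ[R] E) (r : E →ₗ[R] Q)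
    (h : r ∘ₗ i = LinearMap.id) : Module.Injective R Q where
  out X Y _ _ _ _ f hf g := by
    obtain ⟨k, hk⟩ := Module.Injective.extension_property R E _ _ f hf (i ∘ₗ g)
    refine ⟨r ∘ₗ k, fun x => ?_⟩
    have h₁ := LinearMap.congr_fun hk x
    have h₂ := LinearMap.congr_fun h (g x)
    simp only [LinearMap.comp_apply, LinearMap.id_apply] at h₁ h₂ ⊢
    rw [h₁, h₂]

/-- The evaluation map `C ⊗ Hom(C, M) → M`. -/
def tensorHomEval (C M : Type u) [AddCommGroup C] [Module R C] [AddCommGroup M] [Module R M] :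
    C ⊗[R] (C →ₗ[R] M) →ₗ[R] M :=
  TensorProduct.lift LinearMap.applyₗ

section

variable {C M : Type u} [AddCommGroup C] [Module R C] [AddCommGroup M] [Module R M]

@[simp]
lemma tensorHomEval_tmul (c : C) (f : C →ₗ[R] M) : tensorHomEval C M (c ⊗ₜ f) = f c := rfl

/-- Taking K = C in `homEvalMap` gives C ⊗ Hom(C,I) ≅ Hom(Hom(C,C),I), which the homothety
isomorphism identifies with I through evaluation at the identity. -/
lemma tensorHomEval_bijective_of_injective [Module.FinitePresentation R C]
    (hC : Function.Bijective (LinearMap.lsmul R C)) (I : Type u) [AddCommGroup I] [Module R I]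
    [Module.Injective R I] : Function.Bijective (tensorHomEval (R := R) C I) := by
  have hev : Function.Bijective
      (LinearMap.applyₗ (LinearMap.id : C →ₗ[R] C) : ((C →ₗ[R] C) →ₗ[R] I) →ₗ[R] I) := by
    have hlsmul (r : R) : LinearMap.lsmul R C r = r • LinearMap.id := by ext; simp
    constructor
    · rw [injective_iff_map_eq_zero]
      intro h hh
      ext φ
      obtain ⟨r, rfl⟩ := hC.2 φ
      rw [hlsmul, map_smul]
      simpa using congrArg (r • ·) hh
    · intro x
      let e := LinearEquiv.ofBijective _ hC
      refine ⟨LinearMap.toSpanSingleton R I x ∘ₗ e.symm.toLinearMap, ?_⟩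
      have : e.symm LinearMap.id = 1 := by
        rw [LinearEquiv.symm_apply_eq]
        ext; simp [e]
      simp [this]
  have : tensorHomEval (R := R) C I = LinearMap.applyₗ (LinearMap.id : C →ₗ[R] C) ∘ₗ
      homEvalMap C I C ∘ₗ (TensorProduct.comm R C (C →ₗ[R] I)).toLinearMap := by
    ext; rfl
  rw [this]
  exact hev.comp ((homEvalMap_bijective C I C).comp (LinearEquiv.bijective _))

/-- F ≅ R ⊗ F ≅ Hom(C,C) ⊗ F ≅ Hom(C, C ⊗ F). -/
lemma tensorMk_flip_bijective_of_flat [Module.FinitePresentation R C]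
    (hC : Function.Bijective (LinearMap.lsmul R C)) (F : Type u) [AddCommGroup F] [Module R F]
    [Module.Flat R F] : Function.Bijective (TensorProduct.mk R C F).flip := by
  let e : R ≃ₗ[R] (C →ₗ[R] C) := LinearEquiv.ofBijective (LinearMap.lsmul R C) hC
  let e' : F ≃ₗ[R] (C →ₗ[R] C) ⊗[R] F :=
    (TensorProduct.lid R F).symm ≪≫ₗ TensorProduct.congr e (LinearEquiv.refl R F)
  have : (TensorProduct.mk R C F).flip =
      TensorProduct.rTensorHomToHomRTensor (.id R) C C F ∘ₗ e'.toLinearMap := by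
    ext; simp [e, e']
  rw [this]
  exact (rTensorHomToHomRTensor_bijective C C F).comp e'.bijective

/-- By the triangle identity `hcomp`, an invertible counit at I makes the unit invertible at
Hom(C,I); naturality then carries this to the retract M. -/
lemma tensorMk_flip_bijective_of_retract {I : Type u} [AddCommGroup I] [Module R I]
    (hI : Function.Bijective (tensorHomEval (R := R) C I))
    (i : M →ₗ[R] (C →ₗ[R] I)) (r : (C →ₗ[R] I) →ₗ[R] M) (h : r ∘ₗ i = LinearMap.id) :
    Function.Bijective (TensorProduct.mk R C M).flip := by
  have hcomp (x : C →ₗ[R] I) :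
      tensorHomEval C I ∘ₗ (TensorProduct.mk R C (C →ₗ[R] I)).flip x = x := by
    ext; rfl
  have hri (m : M) : r (i m) = m := LinearMap.congr_fun h m
  constructor
  · rw [injective_iff_map_eq_zero]
    intro m hm
    rw [← hri m, ← hcomp (i m)]
    have : (TensorProduct.mk R C (C →ₗ[R] I)).flip (i m) =
        i.lTensor C ∘ₗ (TensorProduct.mk R C M).flip m := by ext; simp
    rw [this, hm]
    simp
  · intro φ
    refine ⟨r (tensorHomEval C I ∘ₗ i.lTensor C ∘ₗ φ), ?_⟩
    have h₁ : (TensorProduct.mk R C (C →ₗ[R] I)).flip (tensorHomEval C I ∘ₗ i.lTensor C ∘ₗ φ) =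
        i.lTensor C ∘ₗ φ := by
      ext c
      exact hI.1 (LinearMap.congr_fun (hcomp (tensorHomEval C I ∘ₗ i.lTensor C ∘ₗ φ)) c)
    have h₂ (x : C →ₗ[R] I) : (TensorProduct.mk R C M).flip (r x) =
        r.lTensor C ∘ₗ (TensorProduct.mk R C (C →ₗ[R] I)).flip x := by ext; simp
    rw [h₂, h₁, ← LinearMap.comp_assoc, ← LinearMap.lTensor_comp, h, LinearMap.lTensor_id,
      LinearMap.id_comp]

lemma tensorHomEval_bijective_of_retract {P : Type u} [AddCommGroup P] [Module R P]
    (hP : Function.Bijective (TensorProduct.mk R C P).flip)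
    (i : M →ₗ[R] C ⊗[R] P) (r : C ⊗[R] P →ₗ[R] M) (h : r ∘ₗ i = LinearMap.id) :
    Function.Bijective (tensorHomEval (R := R) C M) := by
  have hcomp (x : C ⊗[R] P) :
      tensorHomEval C (C ⊗[R] P) ((TensorProduct.mk R C P).flip.lTensor C x) = x := by
    induction x with
    | zero => simp
    | add x y hx hy => rw [map_add, map_add, hx, hy]
    | tmul c p => simp
  have hri (m : M) : r (i m) = m := LinearMap.congr_fun h m
  have nat {A B : Type u} [AddCommGroup A] [Module R A] [AddCommGroup B] [Module R B]
      (f : A →ₗ[R] B) (x : C ⊗[R] (C →ₗ[R] A)) :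
      tensorHomEval C B ((LinearMap.compRight R f).lTensor C x) = f (tensorHomEval C A x) := by
    induction x with
    | zero => simp
    | add x y hx hy => rw [map_add, map_add, map_add, map_add, hx, hy]
    | tmul c p => simp
  constructor
  · rw [injective_iff_map_eq_zero]
    intro x hx
    obtain ⟨y, hy⟩ := LinearMap.lTensor_surjective C hP.2
      ((LinearMap.compRight R i).lTensor C x)
    have h₁ := nat i x
    rw [← hy, hcomp, hx, map_zero] at h₁
    have h₂ : (LinearMap.compRight R r).lTensor C ((LinearMap.compRight R i).lTensor C x) = x := by
      rw [← LinearMap.comp_apply, ← LinearMap.lTensor_comp]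
      have : LinearMap.compRight R r ∘ₗ LinearMap.compRight R i =
          (LinearMap.id : (C →ₗ[R] M) →ₗ[R] _) := by
        ext f c
        simp [hri]
      rw [this, LinearMap.lTensor_id, LinearMap.id_apply]
    rw [← h₂, ← hy, h₁, map_zero, map_zero]
  · intro m
    refine ⟨(LinearMap.compRight R r).lTensor C
      ((TensorProduct.mk R C P).flip.lTensor C (i m)), ?_⟩
    rw [nat, hcomp, hri]

end

variable {C : ModuleCat.{u} R} [Module.FinitePresentation R C]

/-- C ⊗ M is a retract of C ⊗ Hom(C,I) ≅ I, hence injective, and M ≅ Hom(C, C ⊗ M). -/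
lemma CInjective.of_retract (hC : Function.Bijective (LinearMap.lsmul R C)) {M X : ModuleCat.{u} R}
    (hX : CInjective C X) (i : M →ₗ[R] X) (r : X →ₗ[R] M) (h : r ∘ₗ i = LinearMap.id) :
    CInjective C M := by
  obtain ⟨I, hI, ⟨e⟩⟩ := hX
  have hev := tensorHomEval_bijective_of_injective hC I
  have h' : (r ∘ₗ e.symm.toLinearMap) ∘ₗ (e.toLinearMap ∘ₗ i) = LinearMap.id := by
    ext m
    simpa using LinearMap.congr_fun h m
  have hM := tensorMk_flip_bijective_of_retract hev _ _ h'
  refine ⟨ModuleCat.of R (C ⊗[R] M), ?_, ⟨LinearEquiv.ofBijective _ hM⟩⟩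
  let ev := LinearEquiv.ofBijective _ hev
  refine injective_of_retract (ev.toLinearMap ∘ₗ (e.toLinearMap ∘ₗ i).lTensor C)
    ((r ∘ₗ e.symm.toLinearMap).lTensor C ∘ₗ ev.symm.toLinearMap) ?_
  refine LinearMap.ext fun x => ?_
  simp only [LinearMap.comp_apply, LinearEquiv.coe_coe, LinearEquiv.symm_apply_apply]
  rw [← LinearMap.comp_apply, ← LinearMap.lTensor_comp, h', LinearMap.lTensor_id]

/-- Hom(C,M) is a retract of Hom(C, C ⊗ P) ≅ P, hence projective, and C ⊗ Hom(C,M) ≅ M. -/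
lemma CProjective.of_retract (hC : Function.Bijective (LinearMap.lsmul R C)) {M X : ModuleCat.{u} R}
    (hX : CProjective C X) (i : M →ₗ[R] X) (r : X →ₗ[R] M) (h : r ∘ₗ i = LinearMap.id) :
    CProjective C M := by
  obtain ⟨P, hP, ⟨e⟩⟩ := hX
  have hmk := tensorMk_flip_bijective_of_flat hC P
  have h' : (r ∘ₗ e.symm.toLinearMap) ∘ₗ (e.toLinearMap ∘ₗ i) = LinearMap.id := by
    ext m
    simpa using LinearMap.congr_fun h m
  have hM := tensorHomEval_bijective_of_retract hmk _ _ h'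
  refine ⟨ModuleCat.of R (C →ₗ[R] M), ?_, ⟨(LinearEquiv.ofBijective _ hM).symm⟩⟩
  let mk := LinearEquiv.ofBijective _ hmk
  refine Module.Projective.of_split (mk.symm.toLinearMap ∘ₗ
    LinearMap.compRight R (e.toLinearMap ∘ₗ i)) (LinearMap.compRight R (r ∘ₗ e.symm.toLinearMap) ∘ₗ
    mk.toLinearMap) ?_
  refine LinearMap.ext fun f => ?_
  simp only [LinearMap.comp_apply, LinearEquiv.coe_coe, LinearEquiv.apply_symm_apply]
  exact LinearMap.ext fun c => LinearMap.congr_fun h' (f c)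

end Retracts

/-! ### Vanishing of Ext between the two classes -/

section Vanishing

open Abelian

variable {R : Type u} [CommRing R]

/-- The first syzygy `N'` of a finitely generated module `N` over a Noetherian ring; if
`Ext^i(N, C) = 0` for `i ≥ 1` then the same holds for `N'`. -/
lemma exists_syzygy [IsNoetherianRing R] {C : ModuleCat.{u} R} (N : ModuleCat.{u} R)
    [Module.Finite R N] (hN : ∀ i, 1 ≤ i → Subsingleton (Ext N C i)) :
    ∃ (k : ℕ) (N' : ModuleCat.{u} R) (f : N' →ₗ[R] (Fin k → R)) (g : (Fin k → R) →ₗ[R] N),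
      Module.Finite R N' ∧ Function.Injective f ∧ Function.Exact f g ∧ Function.Surjective g ∧
      (∀ i, 1 ≤ i → Subsingleton (Ext N' C i)) ∧
      Function.Surjective (LinearMap.lcomp R C f) := by
  obtain ⟨k, g, hg⟩ := Module.Finite.exists_fin' R N
  have hS := LinearMap.shortExact_shortComplexKer hg
  have hP : Projective g.shortComplexKer.X₂ :=
    (IsProjective.iff_projective (R := R) (Fin k → R)).mp inferInstance
  refine ⟨k, ModuleCat.of R (LinearMap.ker g), (LinearMap.ker g).subtype, g,
    inferInstanceAs (Module.Finite R (LinearMap.ker g)), (LinearMap.ker g).injective_subtype,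
    LinearMap.exact_subtype_ker_map g, hg, fun i hi => ?_, fun φ => ?_⟩
  · obtain ⟨j, rfl⟩ : ∃ j, i = j + 1 := ⟨i - 1, by omega⟩
    exact subsingleton_ext_X₁ hS (Ext.subsingleton_of_projective _ _ _) (hN _ (by omega))
  · obtain ⟨ψ, hψ⟩ := exists_extension_of_subsingleton_ext_one hS (hN 1 le_rfl)
      (ModuleCat.ofHom φ)
    exact ⟨ψ.hom, congrArg ModuleCat.Hom.hom hψ⟩

/-- If `Ext^i(N, C) = 0` for `i ≥ 1` then `Ext^i(Hom(C, J), Hom(N, I)) = 0` for `i ≥ 1`. -/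
lemma subsingleton_ext_hom_hom [IsNoetherianRing R] (C I J : ModuleCat.{u} R)
    [Module.Injective R I] [Module.Injective R J] (n : ℕ) (N : ModuleCat.{u} R)
    [Module.Finite R N] (hN : ∀ i, 1 ≤ i → Subsingleton (Ext N C i)) :
    Subsingleton (Ext (ModuleCat.of R (C →ₗ[R] J)) (ModuleCat.of R (N →ₗ[R] I)) (n + 1)) := by
  induction n generalizing N with | zero | succ n ih
  all_goals
    obtain ⟨k, N', f, g, hfin, hf, hfg, hg, hN', hsurj⟩ := exists_syzygy N hN
    have hex := LinearMap.exact_lcomp_of_exact_of_surjective I hfg hg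
    have hS := ModuleCat.shortComplex_shortExact (ModuleCat.shortComplexOfCompEqZero
      (LinearMap.lcomp R I g) (LinearMap.lcomp R I f) hex.linearMap_comp_eq_zero) hex
      (LinearMap.lcomp_injective_of_surjective g hg)
      (fun h => Module.Injective.extension_property R I _ _ f hf h)
    have hI : Injective (ModuleCat.of R ((Fin k → R) →ₗ[R] I)) := by
      rw [← Module.injective_iff_injective_object]
      exact injective_of_retract (Module.piEquiv (Fin k) R I).symm.toLinearMap
        (Module.piEquiv (Fin k) R I).toLinearMap (by ext; simp)
  · refine subsingleton_ext_one_to_X₁ hS _ (Ext.subsingleton_of_injective _ _ _) fun φ => ?_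
    -- Hom(C,J) need not be flat; injectivity holds because `homEvalMap` turns this map into
    -- Hom(Hom(f,C),J), and Hom(f,C) is onto.
    have hinj : Function.Injective (f.lTensor (C →ₗ[R] J)) := by
      have hcomp : homEvalMap C J (Fin k → R) ∘ₗ f.lTensor (C →ₗ[R] J) =
          LinearMap.lcomp R J (LinearMap.lcomp R C f) ∘ₗ homEvalMap C J N' := by ext; rfl
      refine Function.Injective.of_comp (f := homEvalMap C J (Fin k → R)) ?_
      rw [← LinearMap.coe_comp, hcomp]
      have : Module.FinitePresentation R N' := Module.finitePresentation_of_finite R N'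
      have hinj' : Function.Injective (LinearMap.lcomp R J (LinearMap.lcomp R C f)) :=
        LinearMap.lcomp_injective_of_surjective _ hsurj
      exact hinj'.comp (homEvalMap_bijective C J N').1
    obtain ⟨ψ, hψ⟩ := Module.Injective.extension_property R I _ _ _ hinj
      (TensorProduct.lift φ.hom)
    refine ⟨ModuleCat.ofHom (TensorProduct.curry ψ), ?_⟩
    ext : 1
    refine LinearMap.ext fun h => LinearMap.ext fun x => ?_
    exact LinearMap.congr_fun hψ (h ⊗ₜ x)
  · exact subsingleton_ext_to_X₁ hS (ih N' hN') (Ext.subsingleton_of_injective _ _ _)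

/-- If `Ext^i(N, C) = 0` for `i ≥ 1` then `Ext^i(N ⊗ P, C ⊗ F) = 0` for `i ≥ 1`. -/
lemma subsingleton_ext_tensor_tensor [IsNoetherianRing R] (C P F : ModuleCat.{u} R)
    [Module.Projective R P] [Module.Flat R F] (n : ℕ) (N : ModuleCat.{u} R)
    [Module.Finite R N] (hN : ∀ i, 1 ≤ i → Subsingleton (Ext N C i)) :
    Subsingleton (Ext (ModuleCat.of R (N ⊗[R] P)) (ModuleCat.of R (C ⊗[R] F)) (n + 1)) := by
  induction n generalizing N with | zero | succ n ih
  all_goals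
    obtain ⟨k, N', f, g, hfin, hf, hfg, hg, hN', hsurj⟩ := exists_syzygy N hN
    have hex := rTensor_exact P hfg hg
    have hS := ModuleCat.shortComplex_shortExact (ModuleCat.shortComplexOfCompEqZero
      (f.rTensor P) (g.rTensor P) hex.linearMap_comp_eq_zero) hex
      (Module.Flat.rTensor_preserves_injective_linearMap f hf)
      (LinearMap.rTensor_surjective P hg)
    have hP : Projective (ModuleCat.of R ((Fin k → R) ⊗[R] P)) :=
      (IsProjective.iff_projective _).mp inferInstance
  · refine subsingleton_ext_one_X₃ hS _ (Ext.subsingleton_of_projective _ _ _) fun φ => ?_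
    have hlift : Function.Surjective (LinearMap.lcomp R (C ⊗[R] F) f) := by
      have : Module.FinitePresentation R N' := Module.finitePresentation_of_finite R N'
      have hcomp : LinearMap.lcomp R (C ⊗[R] F) f ∘ₗ
          TensorProduct.rTensorHomToHomRTensor (.id R) (Fin k → R) C F =
          TensorProduct.rTensorHomToHomRTensor (.id R) N' C F ∘ₗ
            (LinearMap.lcomp R C f).rTensor F := by ext; rfl
      refine Function.Surjective.of_comp
        (g := TensorProduct.rTensorHomToHomRTensor (.id R) (Fin k → R) C F) ?_
      rw [← LinearMap.coe_comp, hcomp]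
      exact (rTensorHomToHomRTensor_bijective C N' F).2.comp
        (LinearMap.rTensor_surjective F hsurj)
    -- Extending φ to R^k ⊗ P amounts to lifting its adjoint P → Hom(N', C ⊗ F), which projectivity
    -- of P allows.
    obtain ⟨ψ, hψ⟩ := Module.projective_lifting_property (LinearMap.lcomp R (C ⊗[R] F) f)
      (TensorProduct.curry φ.hom).flip hlift
    refine ⟨ModuleCat.ofHom (TensorProduct.lift ψ.flip), ?_⟩
    ext : 1
    refine TensorProduct.ext' fun x p => ?_
    exact LinearMap.congr_fun (LinearMap.congr_fun hψ p) x
  · exact subsingleton_ext_X₃ hS (ih N' hN') (Ext.subsingleton_of_projective _ _ _)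

end Vanishing

/-! ### Finite dimension and splitting of (co)resolutions -/

section Main

open Abelian

variable {R : Type u} [CommRing R]

lemma CProjective.cFlat {C M : ModuleCat.{u} R} (h : CProjective C M) : CFlat C M := by
  obtain ⟨P, hP, e⟩ := h
  exact ⟨P, inferInstance, e⟩

lemma CProjective.of_subsingleton (C M : ModuleCat.{u} R) [Subsingleton M] : CProjective C M :=
  ⟨M, inferInstance, ⟨{ (0 : M →ₗ[R] C ⊗[R] M) with
    invFun := 0
    left_inv := fun _ => Subsingleton.elim _ _
    right_inv := fun _ => Subsingleton.elim _ _ }⟩⟩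

lemma CInjective.of_subsingleton (C M : ModuleCat.{u} R) [Subsingleton M] : CInjective C M := by
  have : Subsingleton (C →ₗ[R] M) := ⟨fun f g => by ext; exact Subsingleton.elim _ _⟩
  exact ⟨M, ⟨fun _ _ _ _ _ _ _ _ _ => ⟨0, fun _ => Subsingleton.elim _ _⟩⟩,
    ⟨{ (0 : M →ₗ[R] C →ₗ[R] M) with
      invFun := 0
      left_inv := fun _ => Subsingleton.elim _ _
      right_inv := fun _ => Subsingleton.elim _ _ }⟩⟩

lemma CProjective.of_iso {C M M' : ModuleCat.{u} R} (e : M ≅ M') (h : CProjective C M) :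
    CProjective C M' := by
  obtain ⟨P, hP, ⟨f⟩⟩ := h
  exact ⟨P, hP, ⟨e.toLinearEquiv.symm ≪≫ₗ f⟩⟩

lemma CInjective.of_iso {C M M' : ModuleCat.{u} R} (e : M ≅ M') (h : CInjective C M) :
    CInjective C M' := by
  obtain ⟨I, hI, ⟨f⟩⟩ := h
  exact ⟨I, hI, ⟨e.toLinearEquiv.symm ≪≫ₗ f⟩⟩

section

variable [IsNoetherianRing R] {C : ModuleCat.{u} R}

lemma CInjective.stronglyCCopureInjective (hC : IsSemidualizing C) {M : ModuleCat.{u} R}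
    (hM : CInjective C M) :
    StronglyCCopureInjective C M := by
  intro X hX i hi
  obtain ⟨I, hI, ⟨e⟩⟩ := hM
  obtain ⟨J, hJ, ⟨e'⟩⟩ := hX
  obtain ⟨n, rfl⟩ : ∃ n, i = n + 1 := ⟨i - 1, by omega⟩
  have := hC.finite
  exact subsingleton_ext_of_iso e'.symm.toModuleIso e.symm.toModuleIso
    (subsingleton_ext_hom_hom C I J n C hC.ext_eq_zero)

lemma CProjective.stronglyCCopureProjective (hC : IsSemidualizing C) {M : ModuleCat.{u} R}
    (hM : CProjective C M) :
    StronglyCCopureProjective C M := by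
  intro X hX i hi
  obtain ⟨P, hP, ⟨e⟩⟩ := hM
  obtain ⟨F, hF, ⟨e'⟩⟩ := hX
  obtain ⟨n, rfl⟩ : ∃ n, i = n + 1 := ⟨i - 1, by omega⟩
  have := hC.finite
  exact subsingleton_ext_of_iso e.symm.toModuleIso e'.symm.toModuleIso
    (subsingleton_ext_tensor_tensor C P F n C hC.ext_eq_zero)

end

lemma relInjDim_lt_top_of_mem {𝒳 : ObjectProperty (ModuleCat.{u} R)} {M : ModuleCat.{u} R}
    (h₀ : ∀ Z : ModuleCat.{u} R, Subsingleton Z → 𝒳 Z) (hM : 𝒳 M) : relInjDim 𝒳 M < ⊤ := by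
  let K := (CochainComplex.single₀ (ModuleCat.{u} R)).obj M
  have hzero (n : ℕ) (hn : n ≠ 0) : Subsingleton (K.X n) :=
    ModuleCat.subsingleton_of_isZero (HomologicalComplex.isZero_single_obj_X _ _ _ _ hn)
  have hK : IsCoresolution 𝒳 M K :=
    { mem := fun n => by
        rcases n with _ | n
        · exact hM
        · exact h₀ _ (hzero _ (by omega))
      homology_zero := ⟨HomologicalComplex.singleObjHomologySelfIso _ 0 M⟩
      exact := fun n hn => HomologicalComplex.exactAt_single_obj _ _ _ _ (by omega) }
  refine lt_of_le_of_lt (iInf₂_le K hK) ?_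
  -- The supremum is ⊥ rather than 0 when M is zero, so only the bound by 0 is claimed.
  refine lt_of_le_of_lt (b := ((0 : ℕ) : WithBot ℕ∞)) (iSup₂_le fun n hn => ?_)
    (WithBot.coe_lt_coe.mpr (WithTop.coe_lt_top 0))
  by_cases h : n = 0
  · rw [h]
  · exact absurd (hzero n h) (not_subsingleton_iff_nontrivial.mpr hn)

lemma relProjDim_lt_top_of_mem {𝒳 : ObjectProperty (ModuleCat.{u} R)} {M : ModuleCat.{u} R}
    (h₀ : ∀ Z : ModuleCat.{u} R, Subsingleton Z → 𝒳 Z) (hM : 𝒳 M) : relProjDim 𝒳 M < ⊤ := by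
  let K := (ChainComplex.single₀ (ModuleCat.{u} R)).obj M
  have hzero (n : ℕ) (hn : n ≠ 0) : Subsingleton (K.X n) :=
    ModuleCat.subsingleton_of_isZero (HomologicalComplex.isZero_single_obj_X _ _ _ _ hn)
  have hK : IsResolution 𝒳 M K :=
    { mem := fun n => by
        rcases n with _ | n
        · exact hM
        · exact h₀ _ (hzero _ (by omega))
      homology_zero := ⟨HomologicalComplex.singleObjHomologySelfIso _ 0 M⟩
      exact := fun n hn => HomologicalComplex.exactAt_single_obj _ _ _ _ (by omega) }
  refine lt_of_le_of_lt (iInf₂_le K hK) ?_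
  refine lt_of_le_of_lt (b := ((0 : ℕ) : WithBot ℕ∞)) (iSup₂_le fun n hn => ?_)
    (WithBot.coe_lt_coe.mpr (WithTop.coe_lt_top 0))
  by_cases h : n = 0
  · rw [h]
  · exact absurd (hzero n h) (not_subsingleton_iff_nontrivial.mpr hn)

lemma exists_bound_of_iSup_lt_top {X : ℕ → ModuleCat.{u} R}
    (h : ⨆ (n : ℕ) (_ : Nontrivial (X n)), (n : WithBot ℕ∞) < ⊤) :
    ∃ n : ℕ, ∀ m, n ≤ m → Subsingleton (X m) := by
  obtain ⟨n, hn⟩ : ∃ n : ℕ, (⨆ (n : ℕ) (_ : Nontrivial (X n)), (n : WithBot ℕ∞)) < n := by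
    generalize (⨆ (n : ℕ) (_ : Nontrivial (X n)), (n : WithBot ℕ∞)) = s at h
    induction s with
    | bot => exact ⟨0, WithBot.bot_lt_coe _⟩
    | coe s =>
      obtain ⟨k, rfl⟩ := ENat.ne_top_iff_exists.mp (WithBot.coe_lt_coe.mp h).ne
      exact ⟨k + 1, WithBot.coe_lt_coe.mpr (by exact_mod_cast Nat.lt_succ_self k)⟩
  refine ⟨n, fun m hm => not_nontrivial_iff_subsingleton.mp fun hnt => ?_⟩
  have h₁ : (m : WithBot ℕ∞) < n := lt_of_le_of_lt
    (le_iSup₂ (f := fun (n : ℕ) (_ : Nontrivial (X n)) => (n : WithBot ℕ∞)) m hnt) hn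
  exact absurd hm (not_le.mpr (by exact_mod_cast h₁))

/-- Only surjectivity needs `hK`: the cokernel of K^k → Z^{k+1} is the homology at k + 1. -/
lemma shortExact_cycles (K : CochainComplex (ModuleCat.{u} R) ℕ) (k : ℕ)
    (hK : K.ExactAt (k + 1)) :
    (ShortComplex.mk (K.iCycles k) (K.toCycles k (k + 1)) (by
      rw [← cancel_mono (K.iCycles (k + 1))]; simp)).ShortExact := by
  have hprev : (ComplexShape.up ℕ).prev (k + 1) = k := by simp
  have hnext : (ComplexShape.up ℕ).next k = k + 1 := by simp
  refine { exact := ?_, mono_f := inferInstanceAs (Mono (K.iCycles k)), epi_g := ?_ }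
  · rw [ShortComplex.moduleCat_exact_iff]
    intro x hx
    have hd := ShortComplex.exact_of_f_is_kernel (ShortComplex.mk (K.iCycles k) (K.d k (k + 1))
      (by simp)) (K.cyclesIsKernel k (k + 1) hnext)
    rw [ShortComplex.moduleCat_exact_iff] at hd
    refine hd x ?_
    change K.d k (k + 1) x = 0
    rw [← K.toCycles_i k (k + 1)]
    exact (congrArg (K.iCycles (k + 1)) hx).trans (map_zero _)
  · exact Preadditive.epi_of_isZero_cokernel' _ (K.homologyIsCokernel k (k + 1) hprev)
      hK.isZero_homology

lemma shortExact_opcycles (K : ChainComplex (ModuleCat.{u} R) ℕ) (k : ℕ)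
    (hK : K.ExactAt (k + 1)) :
    (ShortComplex.mk (K.fromOpcycles (k + 1) k) (K.pOpcycles k) (by
      rw [← cancel_epi (K.pOpcycles (k + 1))]; simp)).ShortExact := by
  have hprev : (ComplexShape.down ℕ).prev k = k + 1 := by simp
  have hnext : (ComplexShape.down ℕ).next (k + 1) = k := by simp
  refine { exact := ?_, mono_f := ?_, epi_g := inferInstanceAs (Epi (K.pOpcycles k)) }
  · rw [ShortComplex.moduleCat_exact_iff]
    intro x hx
    have hd := ShortComplex.exact_of_g_is_cokernel (ShortComplex.mk (K.d (k + 1) k) (K.pOpcycles k)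
      (by simp)) (K.opcyclesIsCokernel (k + 1) k hprev)
    rw [ShortComplex.moduleCat_exact_iff] at hd
    obtain ⟨y, hy⟩ := hd x hx
    refine ⟨K.pOpcycles (k + 1) y, ?_⟩
    rw [← hy]
    exact congrArg (fun f => f.hom y) (K.p_fromOpcycles (k + 1) k)
  · exact Preadditive.mono_of_isZero_kernel' _ (K.homologyIsKernel (k + 1) k hnext)
      hK.isZero_homology

variable [IsNoetherianRing R] {C : ModuleCat.{u} R}

lemma cInjective_of_cInjDim_lt_top (hC : IsSemidualizing C) {M : ModuleCat.{u} R}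
    (hM : StronglyCCopureInjective C M) (hdim : cInjDim C M < ⊤) : CInjective C M := by
  have := hC.finite
  have : Module.FinitePresentation R C := Module.finitePresentation_of_finite R C
  simp only [cInjDim, relInjDim, iInf_lt_iff] at hdim
  obtain ⟨K, hK, hlt⟩ := hdim
  obtain ⟨n, hn⟩ := exists_bound_of_iSup_lt_top hlt
  obtain ⟨e⟩ := hK.homology_zero
  let e' := K.isoHomologyπ₀ ≪≫ e
  have hS (k : ℕ) := shortExact_cycles K k (hK.exact (k + 1) (by omega))
  -- Starting from Z^0 ≅ M, Ext^i(X, Z^{k+1}) lies between Ext^i(X, K^k) = 0 and Ext^{i+1}(X, Z^k) =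
  -- 0.
  have hcop (k : ℕ) : StronglyCCopureInjective C (K.cycles k) := by
    induction k with
    | zero => exact fun X hX i hi => subsingleton_ext_of_iso (Iso.refl X) e'.symm (hM X hX i hi)
    | succ k ih =>
      exact fun X hX i hi => subsingleton_ext_to_X₃ (hS k)
        ((hK.mem k).stronglyCCopureInjective hC X hX i hi) (ih X hX _ (by omega))
  have hinj (j : ℕ) (hj : j ≤ n) : CInjective C (K.cycles j) := by
    induction hj using Nat.decreasingInduction with
    | self =>
      have := hn n le_rfl
      have : Subsingleton (K.cycles n) :=
        ((ModuleCat.mono_iff_injective (K.iCycles n)).mp inferInstance).subsingleton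
      exact CInjective.of_subsingleton C _
    | of_succ k hk ih =>
      -- Z^{k+1} is C-injective by induction and Z^k is copure, so Ext^1(Z^{k+1}, Z^k) = 0 and the
      -- identity of Z^k extends to a retraction.
      obtain ⟨r, hr⟩ := exists_extension_of_subsingleton_ext_one (hS k)
        (hcop k _ ih 1 le_rfl) (𝟙 (K.cycles k))
      exact CInjective.of_retract hC.homothety_bijective (hK.mem k) (K.iCycles k).hom r.hom
        (congrArg ModuleCat.Hom.hom hr)
  exact (hinj 0 (Nat.zero_le n)).of_iso e'

lemma cProjective_of_cProjDim_lt_top (hC : IsSemidualizing C) {M : ModuleCat.{u} R}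
    (hM : StronglyCCopureProjective C M) (hdim : cProjDim C M < ⊤) : CProjective C M := by
  have := hC.finite
  have : Module.FinitePresentation R C := Module.finitePresentation_of_finite R C
  simp only [cProjDim, relProjDim, iInf_lt_iff] at hdim
  obtain ⟨K, hK, hlt⟩ := hdim
  obtain ⟨n, hn⟩ := exists_bound_of_iSup_lt_top hlt
  obtain ⟨e⟩ := hK.homology_zero
  let e' := K.isoHomologyι₀.symm ≪≫ e
  have hS (k : ℕ) := shortExact_opcycles K k (hK.exact (k + 1) (by omega))
  have hcop (k : ℕ) : StronglyCCopureProjective C (K.opcycles k) := by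
    induction k with
    | zero => exact fun X hX i hi => subsingleton_ext_of_iso e'.symm (Iso.refl X) (hM X hX i hi)
    | succ k ih =>
      exact fun X hX i hi => subsingleton_ext_X₁ (hS k)
        ((hK.mem k).stronglyCCopureProjective hC X hX i hi) (ih X hX _ (by omega))
  have hproj (j : ℕ) (hj : j ≤ n) : CProjective C (K.opcycles j) := by
    induction hj using Nat.decreasingInduction with
    | self =>
      have := hn n le_rfl
      have : Subsingleton (K.opcycles n) :=
        ((ModuleCat.epi_iff_surjective (K.pOpcycles n)).mp inferInstance).subsingleton
      exact CProjective.of_subsingleton C _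
    | of_succ k hk ih =>
      -- Copure projectivity is tested on C-flat modules, so the C-projective kernel is first viewed
      -- as C-flat; the identity then lifts to a section.
      obtain ⟨s, hs⟩ := exists_lift_of_subsingleton_ext_one (hS k)
        (hcop k _ ih.cFlat 1 le_rfl) (𝟙 (K.opcycles k))
      exact CProjective.of_retract hC.homothety_bijective (hK.mem k) s.hom (K.pOpcycles k).hom
        (congrArg ModuleCat.Hom.hom hs)
  exact (hproj 0 (Nat.zero_le n)).of_iso e'

end Main

end Semidualizing

theorem theorem4p13 {R : Type u} [CommRing R] [Nontrivial R] [IsNoetherianRing R]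
    (C : ModuleCat.{u} R) (hC : Semidualizing.IsSemidualizing C) (M : ModuleCat.{u} R) :
    (Semidualizing.CInjective C M ↔
      Semidualizing.StronglyCCopureInjective C M ∧ Semidualizing.cInjDim C M < ⊤) ∧
    (Semidualizing.CProjective C M ↔
      Semidualizing.StronglyCCopureProjective C M ∧ Semidualizing.cProjDim C M < ⊤) := by
  refine ⟨⟨fun h => ⟨h.stronglyCCopureInjective hC, ?_⟩, fun h => ?_⟩,
    ⟨fun h => ⟨h.stronglyCCopureProjective hC, ?_⟩, fun h => ?_⟩⟩
  · exact Semidualizing.relInjDim_lt_top_of_mem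
      (fun Z _ => Semidualizing.CInjective.of_subsingleton C Z) h
  · exact Semidualizing.cInjective_of_cInjDim_lt_top hC h.1 h.2
  · exact Semidualizing.relProjDim_lt_top_of_mem
      (fun Z _ => Semidualizing.CProjective.of_subsingleton C Z) h
  · exact Semidualizing.cProjective_of_cProjDim_lt_top hC h.1 h.2
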